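/- Let $\mathcal B=\{(-1,1),(0,1),(1,0),(1,-1)\}\subset\mathbb Z^2$. For $n,i,j\ge 0$ let $q_n(i,j)$ be the number of walks of length $n$ with steps in $\mathcal B$ that start at $(0,0)$, end at $(i,j)$, and stay in the quarter plane $\mathbb N^2$, where $\mathbb N=\{0,1,2,\dots\}$. Then $\sum_{n\ge0} q_n(i,j)\,2^{-n}$ converges for all $i,j\ge0$, so that $$Q_{\mathcal B}(x,y,\tfrac12)=\sum_{i,j\ge 0}\Bigl(\sum_{n\ge 0}\frac{q_n(i,j)}{2^{n}}\Bigr)x^iy^j$$ is a well-defined formal power series, and the following identities of formal power series in $x$ hold: $$Q_{\mathcal B}(x,0,\tfrac12)=\sum_{n\ge0}\frac{M_n}{2^n}\,x^n =2\sum_{n\ge0}\Bigl(-\frac x2\Bigr)^n\sum_{k=0}^{n+1}\binom{n+1}{k}\bigl(2^{n+k+2}-1\bigr)B_{n+k+2}.$$ Here $(B_n)_{n\ge0}$ are the Bernoulli numbers, $\sum_{n\ge0}B_n\frac{x^n}{n!}=\frac{x}{e^x-1}$, and $(M_n)_{n\ge0}=(1,2,8,56,608,\dots)$ are the median Genocchi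 numbers (OEIS A005439), defined by Seidel's triangle: its first row is $s_{1,0}=1$, and for $n\ge0$ $$s_{2n+2,j}=\sum_{l=j}^{n}s_{2n+1,l}\quad(0\le j\le n),\qquad s_{2n+3,j}=\sum_{m=0}^{\min(j,n)}s_{2n+2,m}\quad(0\le j\le n+1);$$ then $M_n=s_{2n+2,0}$. -/

import Mathlib

open scoped PowerSeries

noncomputable section

/-- The walks of length `n` with steps in `S` that start at `(0,0)`, end at `(i,j)` and stay in the
quarter plane. A walk is given by the sequence of its `n + 1` successive positions. -/
def quarterPlaneWalks (S : Finset (ℤ × ℤ)) (n i j : ℕ) : Set (Fin (n + 1) → ℤ × ℤ) :=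
  {w | w 0 = (0, 0) ∧ w (Fin.last n) = ((i : ℤ), (j : ℤ)) ∧
    (∀ k : Fin n, w k.succ - w k.castSucc ∈ S) ∧
    ∀ k : Fin (n + 1), 0 ≤ (w k).1 ∧ 0 ≤ (w k).2}

/-- The number of walks of length `n` from `(0,0)` to `(i,j)` in the quarter plane. For a finite
step set `S` there are finitely many such walks, so `Set.ncard` is the true cardinality. -/
def walkCount (S : Finset (ℤ × ℤ)) (n i j : ℕ) : ℕ :=
  (quarterPlaneWalks S n i j).ncard

/-- The series `Q_S(x,y,t) = ∑_{i,j} (∑_n #{(0,0) → (i,j) in n steps} t^n) x^i y^j` at a real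
number `t`, as an element of `ℝ⟦y⟧⟦x⟧`: the outer variable is `x` and the inner one is `y`. -/
def walkSeries (S : Finset (ℤ × ℤ)) (t : ℝ) : ℝ⟦X⟧⟦X⟧ :=
  PowerSeries.mk fun i => PowerSeries.mk fun j => ∑' n : ℕ, (walkCount S n i j : ℝ) * t ^ n

/-- The section `Q_S(x,0,t)`, obtained by setting `y = 0` in every coefficient of `x^i`. -/
def walkSeriesAtYZero (S : Finset (ℤ × ℤ)) (t : ℝ) : ℝ⟦X⟧ :=
  PowerSeries.map (PowerSeries.constantCoeff (R := ℝ)) (walkSeries S t)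

/-- The step set of model `B`: NW, N, E, SE. -/
def modelB : Finset (ℤ × ℤ) := {(-1, 1), (0, 1), (1, 0), (1, -1)}

/-- The rows of odd rank of Seidel's triangle (boustrophedon summation)
```
1
1
1  1
2  1
2  3  3
8  6  3
8 14 17 17
```
`seidelOddRow n j`, for `0 ≤ j ≤ n`, is the entry in column `j` (from the left, starting at `0`) of
row `2 n + 1`. A row of even rank consists of the sums of the row above it taken from the right, and
the following row of odd rank consists of the sums of that row taken from the left. -/
def seidelOddRow : ℕ → ℕ → ℕ
  | 0, _ => 1
  | n + 1, j => ∑ m ∈ Finset.range (j + 1), ∑ l ∈ Finset.Icc m n, seidelOddRow n l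

/-- The median Genocchi numbers `1, 2, 8, 56, 608, …`: `medianGenocchi n` is the leftmost entry of
the row of rank `2 n + 2` of Seidel's triangle, that is, the sum of row `2 n + 1`. -/
def medianGenocchi (n : ℕ) : ℕ :=
  ∑ l ∈ Finset.range (n + 1), seidelOddRow n l

end

/-! Let `L` be the linear functional on polynomials sending `X ^ m` to the Genocchi number `2 (1 - 2
^ m) B_m`. Both sides are values of `L`. Seidel's triangle: `L` kills every polynomial invariant
under `X ↦ -1 - X`, and odd powers beyond `X`. So the geometric sums producing consecutive rows
telescope under `L` with one end vanishing (`seidelOddRow_eq`). Walks: the last-step recurrence at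
`t = 1/2` is solved by `2 L(u ^ a v ^ b)` for any `u`, `v` on the kernel curve `(u - v) ^ 2 + u + v
= 0`. This rational curve has a parametrization for which `L(u ^ k) = 0` and `L(v ^ k)` is nonzero
only at `k = 1`: the zero boundary values plus the source from the empty walk. Uniqueness on
antidiagonals gives `shiftedSum_eq`; setting `b = 1` finishes. -/

/-! ### Genocchi numbers and their functional -/

/-- The Genocchi functional. -/
noncomputable def genocchiFunctional : Polynomial ℝ →ₗ[ℝ] ℝ :=
  (Polynomial.basisMonomials ℝ).constr ℝ fun m : ℕ => 2 * (1 - (2 : ℝ) ^ m) * (bernoulli m : ℝ)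

theorem genocchiFunctional_X_pow (m : ℕ) :
    genocchiFunctional (Polynomial.X ^ m) = 2 * (1 - (2 : ℝ) ^ m) * (bernoulli m : ℝ) := by
  have h : (Polynomial.X ^ m : Polynomial ℝ) = Polynomial.basisMonomials ℝ m := by
    simp [Polynomial.X_pow_eq_monomial]
  rw [h, genocchiFunctional, Module.Basis.constr_basis]

theorem genocchiFunctional_X_pow_odd {m : ℕ} (hm : Odd m) (h1 : 1 < m) :
    genocchiFunctional (Polynomial.X ^ m) = 0 := by
  rw [genocchiFunctional_X_pow, bernoulli_eq_zero_of_odd hm h1]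
  simp

/-- The exponential generating function of the Genocchi numbers is `2 t / (e ^ t + 1)`. -/
theorem genocchi_powerSeries :
    (2 * bernoulliPowerSeries ℝ - 2 * PowerSeries.rescale (2 : ℝ) (bernoulliPowerSeries ℝ)) *
      (PowerSeries.exp ℝ + 1) = 2 * PowerSeries.X := by
  have h1 := bernoulliPowerSeries_mul_exp_sub_one ℝ
  have h2 := congrArg (PowerSeries.rescale (2 : ℝ)) h1
  have h3 := PowerSeries.exp_pow_eq_rescale_exp (A := ℝ) 2
  have h4 : PowerSeries.rescale (2 : ℝ) PowerSeries.X = 2 * PowerSeries.X := by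
    rw [PowerSeries.rescale_X, map_ofNat]
  rw [map_mul, map_sub, map_one, h4] at h2
  push_cast at h3
  rw [← h3] at h2
  have h0 : (PowerSeries.exp ℝ - 1) ≠ 0 := by
    intro h
    have := congrArg (PowerSeries.coeff 1) h
    simp [PowerSeries.coeff_exp, PowerSeries.coeff_one] at this
  apply mul_right_cancel₀ h0
  -- Uses `(e ^ t - 1) (e ^ t + 1) = e ^ (2 t) - 1`.
  linear_combination 2 * (PowerSeries.exp ℝ + 1) * h1 - 2 * h2

theorem sum_choose_mul_genocchi (m : ℕ) :
    ∑ k ∈ Finset.range (m + 1), (m.choose k : ℝ) * (2 * (1 - (2 : ℝ) ^ k) * (bernoulli k : ℝ)) +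
      2 * (1 - (2 : ℝ) ^ m) * (bernoulli m : ℝ) = if m = 1 then 2 else 0 := by
  have h := congrArg (PowerSeries.coeff m) genocchi_powerSeries
  have h2 : ∀ f : PowerSeries ℝ, 2 * f = PowerSeries.C (2 : ℝ) * f := fun f => by rw [map_ofNat]
  rw [mul_add, map_add, PowerSeries.coeff_mul,
    Finset.Nat.sum_antidiagonal_eq_sum_range_succ_mk] at h
  simp only [mul_one, h2, map_sub, PowerSeries.coeff_C_mul, PowerSeries.coeff_rescale,
    bernoulliPowerSeries, PowerSeries.coeff_mk, PowerSeries.coeff_exp, PowerSeries.coeff_X,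
    map_div₀, map_one, map_natCast, eq_ratCast] at h
  have hm : (m.factorial : ℝ) ≠ 0 := by positivity
  have h' := congrArg (fun t => (m.factorial : ℝ) * t) h
  simp only [mul_add, Finset.mul_sum] at h'
  convert h' using 1
  · congr 1
    · refine Finset.sum_congr rfl fun k hk => ?_
      have hk' : k ≤ m := by simpa [Nat.lt_succ_iff] using hk
      rw [Nat.cast_choose ℝ hk']
      have h3 : (k.factorial : ℝ) ≠ 0 := by positivity
      have h4 : ((m - k).factorial : ℝ) ≠ 0 := by positivity
      field_simp
    · field_simp
  · by_cases h1 : m = 1 <;> simp [h1]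

/-- Umbral form of `(e ^ t + 1) G(t) = 2 t`, checked on monomials. -/
theorem genocchiFunctional_comp_X_add_one (p : Polynomial ℝ) :
    genocchiFunctional (p.comp (Polynomial.X + 1)) + genocchiFunctional p =
      2 * p.derivative.eval 0 := by
  induction p using Polynomial.induction_on' with
  | add p q hp hq => simp only [Polynomial.add_comp, map_add, Polynomial.eval_add]; linarith
  | monomial m a =>
    rw [← Polynomial.C_mul_X_pow_eq_monomial, ← Polynomial.smul_eq_C_mul, Polynomial.smul_comp,
      Polynomial.X_pow_comp, map_smul, map_smul, add_pow]
    have h := sum_choose_mul_genocchi m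
    have h2 : genocchiFunctional (∑ k ∈ Finset.range (m + 1),
        Polynomial.X ^ k * 1 ^ (m - k) * (m.choose k : Polynomial ℝ)) =
        ∑ k ∈ Finset.range (m + 1),
          (m.choose k : ℝ) * (2 * (1 - (2 : ℝ) ^ k) * (bernoulli k : ℝ)) := by
      rw [map_sum]
      refine Finset.sum_congr rfl fun k _ => ?_
      rw [one_pow, mul_one, mul_comm, ← nsmul_eq_mul, map_nsmul, genocchiFunctional_X_pow,
        nsmul_eq_mul]
    rw [h2, genocchiFunctional_X_pow, ← smul_add, h]
    rcases m with _ | _ | m <;> simp [mul_comm]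

theorem genocchiFunctional_comp_neg_X (p : Polynomial ℝ) :
    genocchiFunctional (p.comp (-Polynomial.X)) =
      genocchiFunctional p - 2 * p.derivative.eval 0 := by
  induction p using Polynomial.induction_on' with
  | add p q hp hq => simp only [Polynomial.add_comp, map_add, Polynomial.eval_add]; linarith
  | monomial m a =>
    rw [← Polynomial.C_mul_X_pow_eq_monomial, ← Polynomial.smul_eq_C_mul, Polynomial.smul_comp,
      Polynomial.X_pow_comp, map_smul, map_smul]
    rcases Nat.even_or_odd m with hm | hm
    · rw [hm.neg_pow]
      rcases m with _ | _ | m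
      · simp
      · simp at hm
      · simp
    · rw [hm.neg_pow, map_neg]
      rcases eq_or_ne m 1 with rfl | h1
      · rw [genocchiFunctional_X_pow]; simp [bernoulli_one]; ring
      · have h1' : 1 < m := by have := hm.pos; omega
        rw [genocchiFunctional_X_pow_odd hm h1']
        obtain ⟨k, rfl⟩ : ∃ k, m = k + 2 := ⟨m - 2, by omega⟩
        simp

/-- The reflection is `X ↦ -X` composed with a unit shift. Applied to `p (X - 1)`, the two
functional equations have cancelling derivative terms and leave `L p = -L p`. -/
theorem genocchiFunctional_eq_zero_of_symm {p : Polynomial ℝ}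
    (hp : p.comp (-1 - Polynomial.X) = p) : genocchiFunctional p = 0 := by
  have h1 := genocchiFunctional_comp_neg_X (p.comp (Polynomial.X - 1))
  have h2 := genocchiFunctional_comp_X_add_one (p.comp (Polynomial.X - 1))
  have e1 : (p.comp (Polynomial.X - 1)).comp (-Polynomial.X) = p := by
    conv_rhs => rw [← hp]
    rw [Polynomial.comp_assoc]
    congr 1
    simp only [Polynomial.sub_comp, Polynomial.X_comp, Polynomial.one_comp]
    ring
  have e2 : (p.comp (Polynomial.X - 1)).comp (Polynomial.X + 1) = p := by
    rw [Polynomial.comp_assoc]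
    simp
  rw [e1] at h1
  rw [e2] at h2
  linarith

theorem genocchiFunctional_X_mul_X_add_one_pow (k : ℕ) :
    genocchiFunctional ((Polynomial.X * (1 + Polynomial.X)) ^ k) = 0 := by
  apply genocchiFunctional_eq_zero_of_symm
  simp only [Polynomial.pow_comp, Polynomial.mul_comp, Polynomial.add_comp, Polynomial.X_comp,
    Polynomial.one_comp]
  ring

/-! ### Seidel's triangle and median Genocchi numbers -/

theorem sum_Icc_X_pow_mul {n m : ℕ} (hm : m ≤ n + 1) :
    ∑ l ∈ Finset.Icc m n,
      (Polynomial.X ^ (n + l + 2) * (1 + Polynomial.X) ^ (n - l) : Polynomial ℝ) =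
      Polynomial.X ^ (n + m + 2) * (1 + Polynomial.X) ^ (n + 1 - m) -
        Polynomial.X ^ (2 * n + 3) := by
  induction hd : n + 1 - m generalizing m with
  | zero =>
    obtain rfl : m = n + 1 := by omega
    rw [Finset.Icc_eq_empty (by omega)]
    simp only [Finset.sum_empty, pow_zero, mul_one]
    rw [show n + (n + 1) + 2 = 2 * n + 3 by ring, sub_self]
  | succ d ih =>
    have h := ih (m := m + 1) (by omega) (by omega)
    rw [← Finset.insert_Icc_add_one_left_eq_Icc (by omega : m ≤ n), Finset.sum_insert (by simp), h,
      show n - m = d by omega]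
    ring

theorem sum_range_X_pow_mul {n j : ℕ} (hj : j ≤ n + 1) :
    ∑ m ∈ Finset.range (j + 1),
      (Polynomial.X ^ (n + m + 2) * (1 + Polynomial.X) ^ (n + 1 - m) : Polynomial ℝ) =
      (Polynomial.X * (1 + Polynomial.X)) ^ (n + 2) -
        Polynomial.X ^ (n + 1 + j + 2) * (1 + Polynomial.X) ^ (n + 1 - j) := by
  induction j with
  | zero => simp [mul_pow]; ring
  | succ j ih =>
    rw [Finset.sum_range_succ, ih (by omega)]
    obtain ⟨d, rfl⟩ : ∃ d, n = j + d := ⟨n - j, by omega⟩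
    rw [show j + d + 1 - j = d + 1 by omega, show j + d + 1 - (j + 1) = d by omega]
    ring

/-- The far end of the telescoping sum is the odd power `X ^ (2 n + 3)`, which `L` kills. The case
`m = n + 1` covers the empty sum at the end of a row. -/
theorem sum_Icc_genocchiFunctional {n m : ℕ} (hm : m ≤ n + 1) :
    ∑ l ∈ Finset.Icc m n,
      genocchiFunctional (Polynomial.X ^ (n + l + 2) * (1 + Polynomial.X) ^ (n - l)) =
      genocchiFunctional (Polynomial.X ^ (n + m + 2) * (1 + Polynomial.X) ^ (n + 1 - m)) := by
  rw [← map_sum, sum_Icc_X_pow_mul hm, map_sub,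
    genocchiFunctional_X_pow_odd ⟨n + 1, by ring⟩ (by omega), sub_zero]

theorem seidelOddRow_eq (n : ℕ) : ∀ j ≤ n, (seidelOddRow n j : ℝ) =
    (-1) ^ (n + 1) *
      genocchiFunctional (Polynomial.X ^ (n + j + 2) * (1 + Polynomial.X) ^ (n - j)) := by
  induction n with
  | zero =>
    intro j hj
    obtain rfl : j = 0 := by omega
    simp [seidelOddRow, genocchiFunctional_X_pow, bernoulli_two]
    norm_num
  | succ n ih =>
    intro j hj
    have h : ∀ m ∈ Finset.range (j + 1),
        ((∑ l ∈ Finset.Icc m n, seidelOddRow n l : ℕ) : ℝ) = (-1) ^ (n + 1) *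
          genocchiFunctional (Polynomial.X ^ (n + m + 2) * (1 + Polynomial.X) ^ (n + 1 - m)) := by
      intro m hm
      rw [Finset.mem_range] at hm
      rw [← sum_Icc_genocchiFunctional (by omega), Finset.mul_sum, Nat.cast_sum]
      exact Finset.sum_congr rfl fun l hl => ih l (Finset.mem_Icc.1 hl).2
    rw [seidelOddRow, Nat.cast_sum, Finset.sum_congr rfl h, ← Finset.mul_sum, ← map_sum,
      sum_range_X_pow_mul hj, map_sub, genocchiFunctional_X_mul_X_add_one_pow]
    ring

theorem medianGenocchi_eq (n : ℕ) : (medianGenocchi n : ℝ) = (-1) ^ (n + 1) *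
    genocchiFunctional (Polynomial.X * (Polynomial.X * (1 + Polynomial.X)) ^ (n + 1)) := by
  have h := sum_Icc_genocchiFunctional (n := n) (m := 0) (by omega)
  rw [medianGenocchi, Nat.cast_sum, Finset.range_eq_Ico,
    show Finset.Ico 0 (n + 1) = Finset.Icc 0 n from rfl,
    Finset.sum_congr rfl fun l hl => seidelOddRow_eq n l (Finset.mem_Icc.1 hl).2,
    ← Finset.mul_sum, h]
  congr 2
  simp only [add_zero, Nat.sub_zero, mul_pow]
  ring

theorem genocchiFunctional_X_mul_pow (n : ℕ) :
    genocchiFunctional (Polynomial.X * (Polynomial.X * (1 + Polynomial.X)) ^ (n + 1)) =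
      -2 * ∑ k ∈ Finset.range (n + 2),
        ((n + 1).choose k : ℝ) * ((2 : ℝ) ^ (n + k + 2) - 1) * (bernoulli (n + k + 2) : ℝ) := by
  have h : (Polynomial.X * (Polynomial.X * (1 + Polynomial.X)) ^ (n + 1) : Polynomial ℝ) =
      ∑ k ∈ Finset.range (n + 2), (n + 1).choose k • Polynomial.X ^ (n + k + 2) := by
    rw [mul_pow, add_comm 1 Polynomial.X, add_pow, Finset.mul_sum, Finset.mul_sum]
    refine Finset.sum_congr rfl fun k _ => ?_
    rw [nsmul_eq_mul, one_pow]
    ring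
  rw [h, map_sum, Finset.mul_sum]
  refine Finset.sum_congr rfl fun k _ => ?_
  rw [map_nsmul, genocchiFunctional_X_pow, nsmul_eq_mul]
  ring

/-! ### Walks and the last-step recurrence -/

/-- The walks of length `n` from the origin to `p` that stay in the quarter plane. -/
def quarterPlaneWalksTo (S : Finset (ℤ × ℤ)) (n : ℕ) (p : ℤ × ℤ) : Set (Fin (n + 1) → ℤ × ℤ) :=
  {w | w 0 = (0, 0) ∧ w (Fin.last n) = p ∧ (∀ k : Fin n, w k.succ - w k.castSucc ∈ S) ∧
    ∀ k : Fin (n + 1), 0 ≤ (w k).1 ∧ 0 ≤ (w k).2}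

theorem quarterPlaneWalksTo_succ (S : Finset (ℤ × ℤ)) (n : ℕ) {p : ℤ × ℤ}
    (hp : 0 ≤ p.1 ∧ 0 ≤ p.2) : quarterPlaneWalksTo S (n + 1) p =
      ⋃ s ∈ (S : Set (ℤ × ℤ)), (fun w => (Fin.snoc w p : Fin (n + 2) → ℤ × ℤ)) ''
        quarterPlaneWalksTo S n (p - s) := by
  ext w
  simp only [Set.mem_iUnion, Set.mem_image, exists_prop]
  constructor
  · rintro ⟨h0, h1, h2, h3⟩
    refine ⟨p - w (Fin.last n).castSucc, ?_, Fin.init w, ⟨?_, ?_, fun k => ?_, fun k => ?_⟩, ?_⟩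
    · rw [← h1]; exact h2 (Fin.last n)
    · exact h0
    · rw [sub_sub_cancel]; rfl
    · exact h2 k.castSucc
    · exact h3 k.castSucc
    · rw [← h1]; exact Fin.snoc_init_self w
  · rintro ⟨s, hs, v, ⟨h0, h1, h2, h3⟩, rfl⟩
    refine ⟨?_, Fin.snoc_last _ _, fun k => ?_, fun k => ?_⟩
    · rw [← Fin.castSucc_zero, Fin.snoc_castSucc]; exact h0
    · refine Fin.lastCases ?_ (fun k => ?_) k
      · rw [Fin.succ_last, Fin.snoc_last, Fin.snoc_castSucc, h1, sub_sub_cancel]; exact hs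
      · rw [← Fin.castSucc_succ, Fin.snoc_castSucc, Fin.snoc_castSucc]; exact h2 k
    · refine Fin.lastCases ?_ (fun k => ?_) k
      · rw [Fin.snoc_last]; exact hp
      · rw [Fin.snoc_castSucc]; exact h3 k

theorem quarterPlaneWalksTo_of_neg (S : Finset (ℤ × ℤ)) (n : ℕ) {p : ℤ × ℤ}
    (hp : ¬ (0 ≤ p.1 ∧ 0 ≤ p.2)) : quarterPlaneWalksTo S n p = ∅ := by
  refine Set.eq_empty_of_forall_notMem fun w hw => hp ?_
  rw [← hw.2.1]
  exact hw.2.2.2 _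

theorem quarterPlaneWalksTo_zero (S : Finset (ℤ × ℤ)) (p : ℤ × ℤ) :
    quarterPlaneWalksTo S 0 p = if p = 0 then {fun _ => 0} else ∅ := by
  split_ifs with hp
  · subst hp
    ext w
    refine ⟨fun hw => funext fun k => ?_, ?_⟩
    · rw [Fin.fin_one_eq_zero k]; exact hw.1
    · rintro rfl
      exact ⟨rfl, rfl, fun k => k.elim0, fun k => ⟨le_rfl, le_rfl⟩⟩
  · exact Set.eq_empty_of_forall_notMem fun w hw => hp (hw.2.1.symm.trans hw.1)

theorem finite_quarterPlaneWalksTo (S : Finset (ℤ × ℤ)) (n : ℕ) (p : ℤ × ℤ) :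
    (quarterPlaneWalksTo S n p).Finite := by
  induction n generalizing p with
  | zero => rw [quarterPlaneWalksTo_zero]; split_ifs <;> simp
  | succ n ih =>
    by_cases hp : 0 ≤ p.1 ∧ 0 ≤ p.2
    · rw [quarterPlaneWalksTo_succ S n hp]
      exact S.finite_toSet.biUnion fun s _ => (ih _).image _
    · simp [quarterPlaneWalksTo_of_neg S _ hp]

theorem ncard_quarterPlaneWalksTo_succ (S : Finset (ℤ × ℤ)) (n : ℕ) {p : ℤ × ℤ}
    (hp : 0 ≤ p.1 ∧ 0 ≤ p.2) : (quarterPlaneWalksTo S (n + 1) p).ncard =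
      ∑ s ∈ S, (quarterPlaneWalksTo S n (p - s)).ncard := by
  have hinj : Function.Injective fun w : Fin (n + 1) → ℤ × ℤ =>
      (Fin.snoc w p : Fin (n + 2) → ℤ × ℤ) := fun v w h => (Fin.snoc_injective2 h).1
  rw [quarterPlaneWalksTo_succ S n hp, Set.Finite.ncard_biUnion S.finite_toSet
    (fun s _ => (finite_quarterPlaneWalksTo S n _).image _)]
  · rw [finsum_mem_coe_finset]
    exact Finset.sum_congr rfl fun s _ => Set.ncard_image_of_injective _ hinj
  · intro s _ t _ hst
    refine (Set.disjoint_image_iff hinj).2 (Set.disjoint_left.2 fun w hw hw' => hst ?_)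
    exact sub_right_injective (hw.2.1.symm.trans hw'.2.1)

/-- The number of walks of length `n` in model `B` ending at `(a - 1, b - 1)`. -/
noncomputable def shiftedCount (n a b : ℕ) : ℕ :=
  (quarterPlaneWalksTo modelB n ((a : ℤ) - 1, (b : ℤ) - 1)).ncard

theorem walkCount_eq_shiftedCount (n i j : ℕ) :
    walkCount modelB n i j = shiftedCount n (i + 1) (j + 1) := by
  simp [walkCount, shiftedCount, quarterPlaneWalks, quarterPlaneWalksTo]

theorem shiftedCount_zero_left (n b : ℕ) : shiftedCount n 0 b = 0 := by
  rw [shiftedCount, quarterPlaneWalksTo_of_neg _ _ (by simp), Set.ncard_empty]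

theorem shiftedCount_zero_right (n a : ℕ) : shiftedCount n a 0 = 0 := by
  rw [shiftedCount, quarterPlaneWalksTo_of_neg _ _ (by simp), Set.ncard_empty]

theorem shiftedCount_zero (a b : ℕ) :
    shiftedCount 0 (a + 1) (b + 1) = if a = 0 ∧ b = 0 then 1 else 0 := by
  rw [shiftedCount, quarterPlaneWalksTo_zero]
  by_cases h : a = 0 ∧ b = 0
  · simp [h]
  · rw [if_neg h, if_neg]
    · simp
    · simpa [Prod.ext_iff] using h

theorem shiftedCount_succ (n a b : ℕ) : shiftedCount (n + 1) (a + 1) (b + 1) =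
    shiftedCount n (a + 2) b + shiftedCount n a (b + 2) + shiftedCount n (a + 1) b +
      shiftedCount n a (b + 1) := by
  rw [shiftedCount, ncard_quarterPlaneWalksTo_succ _ _ (by simp), modelB,
    Finset.sum_insert (by decide), Finset.sum_insert (by decide), Finset.sum_insert (by decide),
    Finset.sum_singleton, ← modelB]
  simp only [shiftedCount, Prod.mk_sub_mk]
  push_cast
  ring_nf

/-! ### Convergence at `t = 1/2` -/

/-- An upper bound for `∑ n, shiftedCount n a b / 2 ^ n`. -/
noncomputable def countBound (a b : ℕ) : ℝ := ((a + b).factorial : ℝ) ^ 2 * a * b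

/-- On an antidiagonal, `a * b` exceeds the mean of its two neighbours by `1`. The squared factorial
multiplies this surplus by `(a + b + 2) ^ 2` relative to the previous antidiagonal, enough to absorb
the remaining terms and the source. -/
theorem countBound_supersolution (a b : ℕ) :
    (if a = 0 ∧ b = 0 then 1 else 0) + (countBound (a + 2) b + countBound a (b + 2) +
      countBound (a + 1) b + countBound a (b + 1)) / 2 ≤ countBound (a + 1) (b + 1) := by
  have h1 : (if a = 0 ∧ b = 0 then 1 else 0 : ℝ) ≤ 1 := by split_ifs <;> norm_num
  have h2 : (1 : ℝ) ≤ ((a + b + 1).factorial : ℝ) ^ 2 := by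
    exact_mod_cast Nat.one_le_pow _ _ (Nat.factorial_pos _)
  simp only [countBound, show a + 2 + b = a + b + 2 by ring, show a + (b + 2) = a + b + 2 by ring,
    show a + 1 + b = a + b + 1 by ring, show a + (b + 1) = a + b + 1 by ring,
    show a + 1 + (b + 1) = a + b + 2 by ring]
  rw [show (a + b + 2).factorial = (a + b + 2) * (a + b + 1).factorial from rfl]
  push_cast
  set F : ℝ := ((a + b + 1).factorial : ℝ) ^ 2 with hF
  have ha : (0 : ℝ) ≤ a := a.cast_nonneg
  have hb : (0 : ℝ) ≤ b := b.cast_nonneg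
  have key : 1 ≤ F * (((a : ℝ) + b + 2) ^ 2 - (2 * a * b + a + b) / 2) := by
    have : (1 : ℝ) ≤ ((a : ℝ) + b + 2) ^ 2 - (2 * a * b + a + b) / 2 := by
      nlinarith [mul_nonneg ha hb]
    nlinarith
  rw [mul_pow, ← hF]
  linarith

theorem sum_shiftedCount_le (N a b : ℕ) :
    ∑ n ∈ Finset.range N, (shiftedCount n a b : ℝ) * (1 / 2) ^ n ≤ countBound a b := by
  induction N generalizing a b with
  | zero => simp only [Finset.range_zero, Finset.sum_empty, countBound]; positivity
  | succ N ih =>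
    rcases a with _ | a
    · simp [shiftedCount_zero_left, countBound]
    rcases b with _ | b
    · simp [shiftedCount_zero_right, countBound]
    refine le_trans ?_ (countBound_supersolution a b)
    rw [Finset.sum_range_succ', shiftedCount_zero]
    have h : ∑ n ∈ Finset.range N, (shiftedCount (n + 1) (a + 1) (b + 1) : ℝ) * (1 / 2) ^ (n + 1) =
        (∑ n ∈ Finset.range N, (shiftedCount n (a + 2) b : ℝ) * (1 / 2) ^ n +
          ∑ n ∈ Finset.range N, (shiftedCount n a (b + 2) : ℝ) * (1 / 2) ^ n +
          ∑ n ∈ Finset.range N, (shiftedCount n (a + 1) b : ℝ) * (1 / 2) ^ n +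
          ∑ n ∈ Finset.range N, (shiftedCount n a (b + 1) : ℝ) * (1 / 2) ^ n) / 2 := by
      simp only [← Finset.sum_add_distrib, Finset.sum_div]
      refine Finset.sum_congr rfl fun n _ => ?_
      rw [shiftedCount_succ]
      push_cast
      ring
    rw [h]
    push_cast
    linarith [ih (a + 2) b, ih a (b + 2), ih (a + 1) b, ih a (b + 1)]

theorem summable_shiftedCount (a b : ℕ) :
    Summable fun n : ℕ => (shiftedCount n a b : ℝ) * (1 / 2) ^ n :=
  summable_of_sum_range_le (fun _ => by positivity) fun N => sum_shiftedCount_le N a b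

/-- The generating function at `t = 1 / 2` of the walks ending at `(a - 1, b - 1)`. -/
noncomputable def shiftedSum (a b : ℕ) : ℝ := ∑' n : ℕ, (shiftedCount n a b : ℝ) * (1 / 2) ^ n

theorem shiftedSum_zero_left (b : ℕ) : shiftedSum 0 b = 0 := by
  simp [shiftedSum, shiftedCount_zero_left]

theorem shiftedSum_zero_right (a : ℕ) : shiftedSum a 0 = 0 := by
  simp [shiftedSum, shiftedCount_zero_right]

theorem two_mul_shiftedSum (a b : ℕ) : 2 * shiftedSum (a + 1) (b + 1) =
    shiftedSum (a + 2) b + shiftedSum a (b + 2) + shiftedSum (a + 1) b + shiftedSum a (b + 1) +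
      if a = 0 ∧ b = 0 then 2 else 0 := by
  have h := ((((summable_shiftedCount (a + 2) b).hasSum.add
    (summable_shiftedCount a (b + 2)).hasSum).add (summable_shiftedCount (a + 1) b).hasSum).add
    (summable_shiftedCount a (b + 1)).hasSum).div_const 2
  have h2 : ∀ n, (shiftedCount (n + 1) (a + 1) (b + 1) : ℝ) * (1 / 2) ^ (n + 1) =
      ((shiftedCount n (a + 2) b : ℝ) * (1 / 2) ^ n + (shiftedCount n a (b + 2) : ℝ) * (1 / 2) ^ n +
        (shiftedCount n (a + 1) b : ℝ) * (1 / 2) ^ n +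
        (shiftedCount n a (b + 1) : ℝ) * (1 / 2) ^ n) / 2 := by
    intro n
    rw [shiftedCount_succ]
    push_cast
    ring
  rw [shiftedSum.eq_1 (a + 1) (b + 1), (summable_shiftedCount (a + 1) (b + 1)).tsum_eq_zero_add, tsum_congr h2,
    h.tsum_eq, shiftedCount_zero]
  unfold shiftedSum
  split_ifs <;> push_cast <;> ring

/-! ### Uniqueness and the explicit solution -/

/-- Uniqueness for the discrete Dirichlet problem on the antidiagonals of the quarter plane. -/
theorem eq_zero_of_antidiagonal_recurrence {D : ℕ → ℕ → ℝ} (hl : ∀ b, D 0 b = 0)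
    (hr : ∀ a, D a 0 = 0)
    (h : ∀ a b, 2 * D (a + 1) (b + 1) = D (a + 2) b + D a (b + 2) + D (a + 1) b + D a (b + 1))
    (a b : ℕ) : D a b = 0 := by
  suffices ∀ m a b, a + b = m → D a b = 0 from this _ a b rfl
  intro m
  induction m with
  | zero =>
    intro a b hab
    obtain rfl : a = 0 := by omega
    exact hl b
  | succ m ih =>
    -- As the previous antidiagonal vanishes, second differences along this one are zero: `D` is
    -- linear in `b`, and its zeros at both ends force it to vanish.
    have key : ∀ b a, a + b = m + 1 → D a b = b * D m 1 := by
      intro b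
      induction b using Nat.strong_induction_on with
      | _ b ihb =>
        intro a hab
        rcases b with _ | _ | b
        · simp [hr]
        · obtain rfl : a = m := by omega
          simp
        · have h1 := h a b
          rw [ihb (b + 1) (by omega) (a + 1) (by omega), ihb b (by omega) (a + 2) (by omega),
            ih (a + 1) b (by omega), ih a (b + 1) (by omega)] at h1
          push_cast at h1 ⊢
          linarith
    have h0 := key (m + 1) 0 (by omega)
    rw [hl] at h0
    have h1 : D m 1 = 0 := by
      rcases mul_eq_zero.1 h0.symm with h2 | h2
      · exact absurd h2 (by positivity)
      · exact h2
    intro a b hab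
    rw [key b a hab, h1, mul_zero]

/-- The polynomial `-X (1 + X) / 2`; together with `X (1 - X) / 2` it parametrizes the kernel curve
`(u - v) ^ 2 + u + v = 0`. -/
noncomputable def kernelU : Polynomial ℝ :=
  Polynomial.C (-1 / 2) * (Polynomial.X * (1 + Polynomial.X))

/-- The polynomial `X (1 - X) / 2`. -/
noncomputable def kernelV : Polynomial ℝ :=
  kernelU + Polynomial.X

theorem kernel_curve : (kernelU - kernelV) ^ 2 + kernelU + kernelV = 0 := by
  have h : (Polynomial.C (-1 / 2) : Polynomial ℝ) * 2 = -1 := by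
    rw [← Polynomial.C_ofNat, ← Polynomial.C_mul]; norm_num
  rw [kernelV, kernelU]
  linear_combination (Polynomial.X * (1 + Polynomial.X)) * h

theorem kernelV_eq_comp : kernelV = kernelU.comp (-Polynomial.X) := by
  have h : (Polynomial.C (-1 / 2) : Polynomial ℝ) * 2 = -1 := by
    rw [← Polynomial.C_ofNat, ← Polynomial.C_mul]; norm_num
  simp only [kernelV, kernelU, Polynomial.mul_comp, Polynomial.C_comp, Polynomial.add_comp,
    Polynomial.X_comp, Polynomial.one_comp]
  linear_combination Polynomial.X * h

theorem genocchiFunctional_kernelU_pow (k : ℕ) : genocchiFunctional (kernelU ^ k) = 0 := by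
  rw [kernelU, mul_pow, ← Polynomial.C_pow, ← Polynomial.smul_eq_C_mul, map_smul,
    genocchiFunctional_X_mul_X_add_one_pow, smul_zero]

theorem genocchiFunctional_kernelV_pow (k : ℕ) :
    genocchiFunctional (kernelV ^ k) = if k = 1 then 1 else 0 := by
  rw [kernelV_eq_comp, ← Polynomial.pow_comp, genocchiFunctional_comp_neg_X,
    genocchiFunctional_kernelU_pow]
  rcases k with _ | _ | k <;>
    simp [kernelU, Polynomial.derivative_pow]
  norm_num

theorem shiftedSum_eq (a b : ℕ) :
    shiftedSum (a + 1) (b + 1) = 2 * genocchiFunctional (kernelU ^ (a + 1) * kernelV ^ (b + 1)) := by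
  -- The difference is reset to `0` on the axes because `2 L(v) = 2`, whereas `shiftedSum 0 1 = 0`;
  -- this mismatch is exactly the source term at `a = b = 0`.
  have h := eq_zero_of_antidiagonal_recurrence (D := fun a b => if a = 0 ∨ b = 0 then 0 else
    shiftedSum a b - 2 * genocchiFunctional (kernelU ^ a * kernelV ^ b)) (by simp) (by simp)
    ?_ (a + 1) (b + 1)
  · simpa [sub_eq_zero] using h
  intro a b
  have hU : genocchiFunctional kernelU = 0 := by simpa using genocchiFunctional_kernelU_pow 1
  have hV : genocchiFunctional kernelV = 1 := by simpa using genocchiFunctional_kernelV_pow 1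
  have h1 := two_mul_shiftedSum a b
  have h2 : genocchiFunctional (kernelU ^ (a + 2) * kernelV ^ b) +
      genocchiFunctional (kernelU ^ a * kernelV ^ (b + 2)) +
      genocchiFunctional (kernelU ^ (a + 1) * kernelV ^ b) +
      genocchiFunctional (kernelU ^ a * kernelV ^ (b + 1)) -
      2 * genocchiFunctional (kernelU ^ (a + 1) * kernelV ^ (b + 1)) = 0 := by
    rw [two_mul, ← map_add, ← map_add, ← map_add, ← map_add, ← map_sub,
      ← map_zero genocchiFunctional]
    congr 1
    linear_combination kernelU ^ a * kernelV ^ b * kernel_curve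
  rcases a with _ | a <;> rcases b with _ | b <;>
    simp [hU, hV, genocchiFunctional_kernelU_pow, genocchiFunctional_kernelV_pow,
      shiftedSum_zero_left, shiftedSum_zero_right] at h1 h2 ⊢ <;> linarith

theorem tsum_walkCount_zero_right (n : ℕ) :
    ∑' m : ℕ, (walkCount modelB m n 0 : ℝ) * (1 / 2) ^ m = -((-1 / 2) ^ n *
      genocchiFunctional (Polynomial.X * (Polynomial.X * (1 + Polynomial.X)) ^ (n + 1))) := by
  -- Since `v = u + X`, a pure power of `u` splits off, and `L` kills it.
  have h : kernelU ^ (n + 1) * kernelV ^ (0 + 1) = kernelU ^ (n + 2) + ((-1 / 2 : ℝ) ^ (n + 1)) •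
      (Polynomial.X * (Polynomial.X * (1 + Polynomial.X)) ^ (n + 1)) := by
    rw [Polynomial.smul_eq_C_mul, Polynomial.C_pow, kernelV, kernelU]
    simp only [mul_pow]
    ring
  simp only [walkCount_eq_shiftedCount]
  rw [← shiftedSum, shiftedSum_eq, h, map_add, genocchiFunctional_kernelU_pow, map_smul,
    smul_eq_mul]
  ring

theorem mainTheorem5 :
    (∀ i j : ℕ, Summable fun n : ℕ => (walkCount modelB n i j : ℝ) * (1 / 2 : ℝ) ^ n) ∧
    walkSeriesAtYZero modelB (1 / 2) =
      PowerSeries.mk (fun n : ℕ => (medianGenocchi n : ℝ) / 2 ^ n) ∧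
    walkSeriesAtYZero modelB (1 / 2) =
      PowerSeries.mk (fun n : ℕ =>
        2 * ((-1 / 2 : ℝ) ^ n * ∑ k ∈ Finset.range (n + 2),
          ((n + 1).choose k : ℝ) * ((2 : ℝ) ^ (n + k + 2) - 1) * (bernoulli (n + k + 2) : ℝ))) := by
  have hcoeff : ∀ n, PowerSeries.coeff n (walkSeriesAtYZero modelB (1 / 2)) = -((-1 / 2) ^ n *
      genocchiFunctional (Polynomial.X * (Polynomial.X * (1 + Polynomial.X)) ^ (n + 1))) := by
    intro n
    rw [← tsum_walkCount_zero_right, walkSeriesAtYZero, PowerSeries.coeff_map, walkSeries,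
      PowerSeries.coeff_mk, ← PowerSeries.coeff_zero_eq_constantCoeff_apply, PowerSeries.coeff_mk]
  refine ⟨fun i j => ?_, ?_, ?_⟩
  · simp only [walkCount_eq_shiftedCount]
    exact summable_shiftedCount _ _
  · ext n
    rw [hcoeff, PowerSeries.coeff_mk, medianGenocchi_eq, div_pow]
    ring
  · ext n
    rw [hcoeff, PowerSeries.coeff_mk, genocchiFunctional_X_mul_pow]
    ring
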